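/- \textbf{Setting.} Let $(\Omega,\mathcal F,(\mathcal F_t)_{t\ge 0},\mathbb P)$ be a filtered probability space carrying an $(\mathcal F_t)$-Brownian motion $B$ and an $\mathcal F_0$-measurable real random variable $X_{0-}$. Let $\alpha\ge 0$, $T\ge 0$ and $b_{\max}\in\mathbb R$, and let $\mathcal B_T$ be the set of $(\mathcal F_t)$-progressively measurable processes $\beta$ whose paths almost surely lie in $$S_T=\{f\in L^2([0,\infty)) : 0\le f\le b_{\max}\text{ a.e.},\ f=0 \text{ a.e. on }(T,\infty)\}.$$ Let $M$ be the set of increasing c\`adl\`ag functions $\ell:[-\infty,\infty]\to[0,1]$ with $\ell_{0-}=0$ and $\ell_\infty=1$ (the cumulative distribution functions of probability measures on $[0,\infty]$), with the topology of weak convergence: $\ell^n\to\ell$ if and only if $\ell^n_t\to\ell_t$ for every continuity point $t\in[0,\infty]$ of $\ell$. For $\ell\in M$ and $\beta\in\mathcal B_T$ put $$X^\ell_t=X_{0-}+\int_0^t\beta_s\,ds+B_t-\alpha\ell_t\ (t\ge 0),\qquad \tau^\ell=\inf\{t\ge 0: X^\ell_t\le 0\}\in[0,\infty],\qquad \Gamma[\ell,\beta]_t=\mathbb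 P(\tau^\ell\le t).$$ A solution of the controlled McKean--Vlasov problem with drift $\beta$ is a c\`adl\`ag function $\Lambda:[0,\infty)\to\mathbb R$ such that, with $X_t=X_{0-}+\int_0^t\beta_s\,ds+B_t-\Lambda_t$, $$\Lambda_t=\alpha\,\mathbb P\Big(\inf_{0\le s\le t}X_s\le 0\Big)\qquad\text{for all }t\ge 0.$$ It is minimal if $\Lambda_t\le\Lambda'_t$ for all $t\ge 0$ and every solution $\Lambda'$ with the same drift. \textbf{Theorem.} For every $\beta\in\mathcal B_T$, the operator $\Gamma[\cdot,\beta]$ maps $M$ into $M$ and is continuous. Furthermore, there is a unique minimal solution $\underline\Lambda(\beta)$ of the controlled McKean--Vlasov problem with drift $\beta$, and $$\underline\Lambda(\beta)=\alpha\lim_{k\to\infty}\Gamma^{(k)}[0,\beta]\quad\text{on }[0,\infty),$$ where $\Gamma^{(k)}[\cdot,\beta]$ is the $k$-th iterate of $\Gamma[\cdot,\beta]$, the limit exists in $M$, and $0$ denotes the element of $M$ that vanishes on $[-\infty,\infty)$ and equals $1$ at $\infty$. -/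

import Mathlib

open MeasureTheory ProbabilityTheory Filter Set
open scoped NNReal Topology

/-- Right-continuous with left limits. -/
def IsCadlag {S : Type*} [TopologicalSpace S] [Preorder S] (f : S → ℝ) : Prop :=
  ∀ t, ContinuousWithinAt f (Ici t) t ∧ ∃ l, Tendsto f (𝓝[<] t) (𝓝 l)

/-- The space `M` of increasing càdlàg functions `ℓ` from the extended real line to `[0, 1]` with
`ℓ_{0-} = 0` and `ℓ_∞ = 1`, that is, of cumulative distribution functions of probability measures
on `[0, ∞]`. -/
@[ext]
structure ExtCDF where
  toFun : EReal → ℝ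
  mem_Icc : ∀ t, toFun t ∈ Icc (0 : ℝ) 1
  cadlag : IsCadlag toFun
  mono : Monotone toFun
  zero_left : Tendsto toFun (𝓝[<] 0) (𝓝 0)
  top_eq : toFun ⊤ = 1

namespace ExtCDF

instance : CoeFun ExtCDF fun _ => EReal → ℝ := ⟨toFun⟩

/-- The topology of weak convergence. The two families of subbasic open sets are
`{ℓ | ℓ_t < c}` and `{ℓ | c < ℓ_{t-}}`; `tendsto_nhds_iff` below shows that convergence in this
topology is convergence at the continuity points of the limit. -/
instance : TopologicalSpace ExtCDF :=
  TopologicalSpace.generateFrom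
    ({U | ∃ (t : EReal) (c : ℝ), U = {ℓ : ExtCDF | ℓ t < c}} ∪
      {U | ∃ (t : EReal) (c : ℝ), U = {ℓ : ExtCDF | ∃ s < t, c < ℓ s}})

theorem isCadlag_zeroFun : IsCadlag (indicator {(⊤ : EReal)} fun _ => (1 : ℝ)) := by
  have key : ∀ (S : Set EReal) (t : EReal), S ⊆ Iio ⊤ →
      Tendsto (indicator {(⊤ : EReal)} fun _ => (1 : ℝ)) (𝓝[S] t) (𝓝 0) := by
    intro S t hS
    refine tendsto_const_nhds.congr' ?_
    filter_upwards [self_mem_nhdsWithin] with s hs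
    have hne : s ≠ ⊤ := (mem_Iio.1 (hS hs)).ne
    simp [hne]
  intro t
  refine ⟨?_, 0, key _ t fun s hs => mem_Iio.2 ((mem_Iio.1 hs).trans_le le_top)⟩
  rcases eq_or_ne t ⊤ with rfl | ht
  · rw [Ici_top]
    exact continuousWithinAt_singleton
  · refine ContinuousAt.continuousWithinAt ?_
    have h2 := key (Iio ⊤) t Subset.rfl
    rw [nhdsWithin_eq_nhds.2 (Iio_mem_nhds (lt_top_iff_ne_top.2 ht))] at h2
    rw [ContinuousAt, indicator_of_notMem (show t ∉ ({⊤} : Set EReal) from ht)]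
    exact h2

/-- The zero function on `[0, ∞)`, with the value `1` at `∞` that membership in `M` prescribes. -/
noncomputable def zero : ExtCDF where
  toFun := indicator {⊤} fun _ => 1
  mem_Icc t := by
    by_cases h : t = ⊤ <;> simp [h]
  cadlag := isCadlag_zeroFun
  mono s t hst := by
    by_cases hs : s = ⊤
    · subst hs
      simp [top_le_iff.1 hst]
    · by_cases ht : t = ⊤ <;> simp [hs, ht]
  zero_left := by
    refine tendsto_const_nhds.congr' ?_
    filter_upwards [self_mem_nhdsWithin] with s hs
    have hne : s ≠ ⊤ := ((mem_Iio.1 hs).trans_le le_top).ne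
    simp [hne]
  top_eq := by simp

theorem eq_zero_of_neg (ℓ : ExtCDF) {t : EReal} (ht : t < 0) : ℓ t = 0 := by
  refine le_antisymm ?_ (ℓ.mem_Icc t).1
  have : (𝓝[<] (0 : EReal)).NeBot := nhdsLT_neBot_of_exists_lt ⟨t, ht⟩
  refine ge_of_tendsto ℓ.zero_left ?_
  filter_upwards [Ioo_mem_nhdsLT ht] with s hs
  exact ℓ.mono hs.1.le

theorem exists_continuousAt (ℓ : ExtCDF) {a b : EReal} (hab : a < b) :
    ∃ r, a < r ∧ r < b ∧ ContinuousAt ℓ r := by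
  obtain ⟨x, hax, hxb⟩ := EReal.lt_iff_exists_real_btwn.1 hab
  obtain ⟨y, hxy, hyb⟩ := EReal.lt_iff_exists_real_btwn.1 hxb
  have hm : Monotone fun r : ℝ => ℓ (r : EReal) :=
    fun r s hrs => ℓ.mono (EReal.coe_le_coe_iff.2 hrs)
  have hd := hm.countable_not_continuousAt.dense_compl ℝ
  obtain ⟨r, hr, hrc⟩ := hd.exists_mem_open isOpen_Ioo (nonempty_Ioo.2 (EReal.coe_lt_coe_iff.1 hxy))
  refine ⟨r, hax.trans (EReal.coe_lt_coe_iff.2 hrc.1), (EReal.coe_lt_coe_iff.2 hrc.2).trans hyb, ?_⟩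
  have hc : ContinuousAt (fun r : ℝ => ℓ (r : EReal)) r := by simpa using hr
  exact EReal.isOpenEmbedding_coe.continuousAt_iff.1 hc

/-- Convergence in `M` is pointwise convergence at the continuity points of the limit. -/
theorem tendsto_nhds_iff {ι : Type*} {F : Filter ι} {u : ι → ExtCDF} {ℓ : ExtCDF} :
    Tendsto u F (𝓝 ℓ) ↔
      ∀ t : EReal, 0 ≤ t → ContinuousAt ℓ t → Tendsto (fun i => u i t) F (𝓝 (ℓ t)) := by
  rw [TopologicalSpace.tendsto_nhds_generateFrom_iff]
  constructor
  · intro h t h0 hc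
    refine tendsto_order.2 ⟨fun c hlt => ?_, fun c hlt => ?_⟩
    · have : (𝓝[<] t).NeBot := nhdsLT_neBot_of_exists_lt ⟨⊥, lt_of_lt_of_le (by simp) h0⟩
      obtain ⟨s, hs, hst⟩ := (((hc.eventually (lt_mem_nhds hlt)).filter_mono
        nhdsWithin_le_nhds).and (self_mem_nhdsWithin (s := Iio t))).exists
      have := h _ (Or.inr ⟨t, c, rfl⟩) ⟨s, hst, hs⟩
      filter_upwards [this] with i hi
      obtain ⟨r, hr, hcr⟩ := hi
      exact hcr.trans_le ((u i).mono hr.le)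
    · exact h _ (Or.inl ⟨t, c, rfl⟩) hlt
  · intro h
    have h' : ∀ t : EReal, ContinuousAt ℓ t → Tendsto (fun i => u i t) F (𝓝 (ℓ t)) := by
      intro t hc
      rcases lt_or_ge t 0 with ht | ht
      · simp only [eq_zero_of_neg _ ht]
        exact tendsto_const_nhds
      · exact h t ht hc
    rintro U (⟨t, c, rfl⟩ | ⟨t, c, rfl⟩) hU
    · change ℓ t < c at hU
      rcases eq_or_ne t ⊤ with rfl | ht
      · refine mem_of_superset univ_mem fun i _ => ?_
        change u i ⊤ < c
        rw [(u i).top_eq]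
        rwa [ℓ.top_eq] at hU
      · have hr := (ℓ.cadlag t).1.eventually (gt_mem_nhds hU)
        obtain ⟨b, hb, hbs⟩ := (mem_nhdsGE_iff_exists_Ico_subset'
          (lt_top_iff_ne_top.2 ht)).1 hr
        obtain ⟨r, htr, hrb, hrc⟩ := ℓ.exists_continuousAt hb
        filter_upwards [(h' r hrc).eventually (gt_mem_nhds (hbs ⟨htr.le, hrb⟩))] with i hi
        exact ((u i).mono htr.le).trans_lt hi
    · obtain ⟨s, hst, hs⟩ := hU
      obtain ⟨r, hsr, hrt, hrc⟩ := ℓ.exists_continuousAt hst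
      filter_upwards [(h' r hrc).eventually (lt_mem_nhds (hs.trans_le (ℓ.mono hsr.le)))] with i hi
      exact ⟨r, hrt, hi⟩

end ExtCDF

section Model

variable {Ω : Type*} {mΩ : MeasurableSpace Ω}

/-- `B` is a Brownian motion relative to the filtration `𝓕`: a Brownian motion (Mathlib's notion:
the finite-dimensional laws of Brownian motion and almost surely continuous paths) adapted to `𝓕`
whose increments after time `s` are independent of `𝓕 s`. -/
structure IsBrownianWrt (B : ℝ≥0 → Ω → ℝ) (𝓕 : Filtration ℝ≥0 mΩ) (P : Measure Ω) : Prop where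
  isBrownian : IsBrownianReal B P
  adapted : ∀ t, Measurable[𝓕 t] (B t)
  indep : ∀ s t, s ≤ t →
    Indep (MeasurableSpace.comap (fun ω => B t ω - B s ω) inferInstance) (𝓕 s) P

/-- The set `S_T` of `f ∈ L²([0, ∞))` with `0 ≤ f ≤ bmax` a.e. that vanish on `(T, ∞)`. -/
def controlSet (T : ℝ≥0) (bmax : ℝ) : Set (ℝ≥0 → ℝ) :=
  {f | MemLp (fun s : ℝ => f s.toNNReal) 2 (volume.restrict (Ici 0)) ∧
    (∀ᵐ s ∂(volume.restrict (Ici (0 : ℝ))), 0 ≤ f s.toNNReal ∧ f s.toNNReal ≤ bmax) ∧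
    ∀ᵐ s ∂(volume.restrict (Ioi (T : ℝ))), f s.toNNReal = 0}

/-- The set `B_T` of admissible controls: progressively measurable processes with paths almost
surely in `S_T`. -/
def IsAdmissible (𝓕 : Filtration ℝ≥0 mΩ) (P : Measure Ω) (T : ℝ≥0) (bmax : ℝ)
    (β : ℝ≥0 → Ω → ℝ) : Prop :=
  IsStronglyProgressive 𝓕 β ∧ ∀ᵐ ω ∂P, (fun t => β t ω) ∈ controlSet T bmax

/-- The process `X_t = X_{0-} + ∫₀ᵗ β_s ds + B_t - Λ_t` for a deterministic loss `Λ`. -/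
noncomputable def stateProcess (X0 : Ω → ℝ) (B β : ℝ≥0 → Ω → ℝ) (Λ : ℝ≥0 → ℝ)
    (t : ℝ≥0) (ω : Ω) : ℝ :=
  X0 ω + (∫ s in (0 : ℝ)..(t : ℝ), β s.toNNReal ω) + B t ω - Λ t

/-- `τ = inf {t ≥ 0 | X_t ≤ 0}`, with value `∞` if there is no such `t`. -/
noncomputable def defaultTime (X : ℝ≥0 → Ω → ℝ) (ω : Ω) : EReal :=
  sInf {r : EReal | ∃ t : ℝ≥0, X t ω ≤ 0 ∧ r = ((t : ℝ) : EReal)}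

/-- The function `Γ[ℓ, β]`, i.e. `t ↦ ℙ(τ ≤ t)` for the default time `τ` of
`X_{0-} + ∫₀ β_s ds + B - α ℓ`. -/
noncomputable def Gamma (P : Measure Ω) (α : ℝ) (X0 : Ω → ℝ) (B β : ℝ≥0 → Ω → ℝ)
    (ℓ : ExtCDF) (t : EReal) : ℝ :=
  P.real {ω | defaultTime (stateProcess X0 B β fun s => α * ℓ ((s : ℝ) : EReal)) ω ≤ t}

/-- The càdlàg function `Λ` on `[0, ∞)` solves the controlled McKean–Vlasov problem: with
`X_t = X_{0-} + ∫₀ᵗ β_s ds + B_t - Λ_t`, one has `Λ_t = α ℙ(inf_{0 ≤ s ≤ t} X_s ≤ 0)`.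
The infimum is taken in the extended reals. -/
def IsSolution (P : Measure Ω) (α : ℝ) (X0 : Ω → ℝ) (B β : ℝ≥0 → Ω → ℝ) (Λ : ℝ≥0 → ℝ) : Prop :=
  IsCadlag Λ ∧ ∀ t, Λ t =
    α * P.real {ω | (⨅ s ∈ Iic t, ((stateProcess X0 B β Λ s ω : ℝ) : EReal)) ≤ 0}

/-- A solution that lies below every other solution at all times. -/
def IsMinimalSolution (P : Measure Ω) (α : ℝ) (X0 : Ω → ℝ) (B β : ℝ≥0 → Ω → ℝ)
    (Λ : ℝ≥0 → ℝ) : Prop :=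
  IsSolution P α X0 B β Λ ∧ ∀ Λ', IsSolution P α X0 B β Λ' → ∀ t, Λ t ≤ Λ' t

end Model

/-! The operator is monotone and weakly continuous on `M`. Its iterates from `zero` therefore
increase, converge, and have a fixed point as limit, and a fixed point multiplied by `α` is a
solution. Any solution dominates `α` times each iterate by induction, because raising the barrier
only creates more hits. Hence it dominates the limit at strictly earlier times, and its
right-continuity closes the gap.

The substance is continuity. Write the default event as the free process `Y` reaching the barrier `g
= α * ℓ`. One half is compactness: `Y - g` is lower semicontinuous, so limits of near-hits are hits
(`exists_measure_hitSet_lt`). This also makes the image right-continuous in time. The other half can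
fail if a path merely touches the barrier, since a slightly smaller loss would then miss it. Falling
strictly below an earlier barrier value is stable under small perturbations of `ℓ`
(`exists_lt_measure_hitSet`), so it suffices that hits almost surely turn into such crossings at
once (`measure_hitSet_diff_crossSet`).

This last fact needs only independence at deterministic times. Let `N` be the event of a hit with no
crossing for some positive time afterwards. Round the first hit up to a fine grid. The next Brownian
increment over a time `h` is independent of the past, and it beats drift and discretisation error
with a probability bounded below uniformly in `h ≤ 1`. This gives `P N ≤ q * P N` with `q < 1`, so
`N` is null. -/

/-! ### Hitting and crossing a monotone barrier -/

section HittingSets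

variable {Ω : Type*} {mΩ : MeasurableSpace Ω}

/-- The event that the process `Y` reaches the barrier `g` up to time `t`. -/
def hitSet (Y : ℝ≥0 → Ω → ℝ) (g : ℝ≥0 → ℝ) (t : ℝ≥0) : Set Ω :=
  {ω | ∃ u ≤ t, Y u ω ≤ g u}

/-- The event that, up to time `t`, the process `Y` falls strictly below an earlier value of
the barrier `g`. -/
def crossSet (Y : ℝ≥0 → Ω → ℝ) (g : ℝ≥0 → ℝ) (t : ℝ≥0) : Set Ω :=
  {ω | ∃ v ≤ t, ∃ w < v, Y v ω < g w}

theorem hitSet_mono (Y : ℝ≥0 → Ω → ℝ) (g : ℝ≥0 → ℝ) : Monotone (hitSet Y g) :=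
  fun _ _ hst _ ⟨u, hu, h⟩ => ⟨u, hu.trans hst, h⟩

theorem hitSet_mono_barrier (Y : ℝ≥0 → Ω → ℝ) {g g' : ℝ≥0 → ℝ} {t : ℝ≥0}
    (h : ∀ u ≤ t, g u ≤ g' u) : hitSet Y g t ⊆ hitSet Y g' t :=
  fun _ ⟨u, hu, hY⟩ => ⟨u, hu, hY.trans (h u hu)⟩

theorem crossSet_mono (Y : ℝ≥0 → Ω → ℝ) (g : ℝ≥0 → ℝ) : Monotone (crossSet Y g) :=
  fun _ _ hst _ ⟨v, hv, h⟩ => ⟨v, hv.trans hst, h⟩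

/-- An increasing right-continuous function is upper semicontinuous. -/
theorem Monotone.upperSemicontinuous_of_rightCont {g : ℝ≥0 → ℝ} (hg : Monotone g)
    (hgc : ∀ t, ContinuousWithinAt g (Ici t) t) : UpperSemicontinuous g := by
  intro t c hc
  have h1 : ∀ᶠ s in 𝓝[≥] t, g s < c := (hgc t).eventually (gt_mem_nhds hc)
  have h2 : ∀ᶠ s in 𝓝[≤] t, g s < c := by
    filter_upwards [self_mem_nhdsWithin] with s hs
    exact (hg hs).trans_lt hc
  rw [← nhdsLE_sup_nhdsGE]
  exact Filter.eventually_sup.2 ⟨h2, h1⟩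

/-- The barrier jumps only upwards, so the gap between path and barrier jumps only downwards. This
is what makes its minimum over a compact time interval attained. -/
theorem lowerSemicontinuous_sub_barrier {y g : ℝ≥0 → ℝ} (hy : Continuous y) (hg : Monotone g)
    (hgc : ∀ t, ContinuousWithinAt g (Ici t) t) : LowerSemicontinuous fun u => y u - g u := by
  have h1 : LowerSemicontinuous fun u => - g u := by
    intro t c hc
    have := hg.upperSemicontinuous_of_rightCont hgc t (-c) (by linarith)
    filter_upwards [this] with s hs
    linarith
  simpa [sub_eq_add_neg] using hy.lowerSemicontinuous.add h1

/-- A path that comes arbitrarily close to the barrier up to time `t` reaches it. -/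
theorem exists_le_of_forall_exists_lt {y g : ℝ≥0 → ℝ} (hy : Continuous y) (hg : Monotone g)
    (hgc : ∀ t, ContinuousWithinAt g (Ici t) t) {t : ℝ≥0}
    (h : ∀ ε > (0 : ℝ), ∃ u ≤ t, y u - g u < ε) : ∃ u ≤ t, y u ≤ g u := by
  obtain ⟨a, ha, hmin⟩ := LowerSemicontinuousOn.exists_isMinOn (s := Icc 0 t)
    ⟨0, by simp⟩ isCompact_Icc
    ((lowerSemicontinuous_sub_barrier hy hg hgc).lowerSemicontinuousOn _)
  refine ⟨a, ha.2, ?_⟩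
  by_contra! hlt
  obtain ⟨u, hu, hu'⟩ := h _ (sub_pos.2 hlt)
  exact absurd (hmin ⟨bot_le, hu⟩ : y a - g a ≤ y u - g u) (not_le.2 hu')

/-- A path that does not reach the barrier up to time `t` stays off it for some time. -/
theorem exists_gt_forall_lt {y g : ℝ≥0 → ℝ} (hy : Continuous y) (hg : Monotone g)
    (hgc : ∀ t, ContinuousWithinAt g (Ici t) t) {t : ℝ≥0}
    (h : ∀ u ≤ t, g u < y u) : ∃ r > t, ∀ u < r, g u < y u := by
  have h1 : ∀ᶠ u in 𝓝 t, (0 : ℝ) < y u - g u :=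
    lowerSemicontinuous_sub_barrier hy hg hgc t 0 (sub_pos.2 (h t le_rfl))
  obtain ⟨r, hr, hsub⟩ := exists_Ico_subset_of_mem_nhds h1 ⟨t + 1, by simp⟩
  refine ⟨r, hr, fun u hu => ?_⟩
  rcases le_total u t with hut | hut
  · exact h u hut
  · exact sub_pos.1 (hsub ⟨hut, hu⟩)

theorem mem_hitSet_of_forall_gt {Y : ℝ≥0 → Ω → ℝ} {g : ℝ≥0 → ℝ} {ω : Ω}
    (hy : Continuous fun t => Y t ω) (hg : Monotone g)
    (hgc : ∀ t, ContinuousWithinAt g (Ici t) t) {t : ℝ≥0}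
    (h : ∀ r > t, ∃ s < r, ω ∈ hitSet Y g s) : ω ∈ hitSet Y g t := by
  by_contra hn
  obtain ⟨r, hr, hr'⟩ := exists_gt_forall_lt hy hg hgc (t := t) fun u hu => by
    by_contra! hle
    exact hn ⟨u, hu, hle⟩
  obtain ⟨s, hs, u, hu, hle⟩ := h r hr
  exact absurd hle (not_le.2 (hr' u (hu.trans_lt hs)))

/-- The default time is at most `t` exactly if the barrier is reached up to time `t`. -/
theorem defaultTime_le_iff {Y : ℝ≥0 → Ω → ℝ} {g : ℝ≥0 → ℝ} {ω : Ω}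
    (hy : Continuous fun t => Y t ω) (hg : Monotone g)
    (hgc : ∀ t, ContinuousWithinAt g (Ici t) t) {t : ℝ≥0} :
    defaultTime (fun s ω => Y s ω - g s) ω ≤ ((t : ℝ) : EReal) ↔ ω ∈ hitSet Y g t := by
  constructor
  · intro h
    refine mem_hitSet_of_forall_gt hy hg hgc fun r hr => ?_
    have : defaultTime (fun s ω => Y s ω - g s) ω < ((r : ℝ) : EReal) :=
      h.trans_lt (by exact_mod_cast hr)
    obtain ⟨_, ⟨u, hu, rfl⟩, hur⟩ := sInf_lt_iff.1 this
    exact ⟨u, by exact_mod_cast hur, u, le_rfl, sub_nonpos.1 hu⟩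
  · rintro ⟨u, hu, hle⟩
    refine le_trans (b := ((u : ℝ) : EReal)) (sInf_le ⟨u, sub_nonpos.2 hle, rfl⟩) ?_
    exact_mod_cast hu

theorem defaultTime_nonneg (X : ℝ≥0 → Ω → ℝ) (ω : Ω) : 0 ≤ defaultTime X ω := by
  refine le_sInf ?_
  rintro _ ⟨u, _, rfl⟩
  exact_mod_cast u.2

/-- The running infimum is nonpositive if the barrier is reached. -/
theorem iInf_le_zero_of_mem_hitSet {Y : ℝ≥0 → Ω → ℝ} {g : ℝ≥0 → ℝ} {ω : Ω} {t : ℝ≥0}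
    (h : ω ∈ hitSet Y g t) : (⨅ s ∈ Iic t, ((Y s ω - g s : ℝ) : EReal)) ≤ 0 := by
  obtain ⟨u, hu, hle⟩ := h
  refine (iInf₂_le u hu).trans ?_
  exact_mod_cast sub_nonpos.2 hle

theorem iInf_le_zero_iff {Y : ℝ≥0 → Ω → ℝ} {g : ℝ≥0 → ℝ} {ω : Ω}
    (hy : Continuous fun t => Y t ω) (hg : Monotone g)
    (hgc : ∀ t, ContinuousWithinAt g (Ici t) t) {t : ℝ≥0} :
    (⨅ s ∈ Iic t, ((Y s ω - g s : ℝ) : EReal)) ≤ 0 ↔ ω ∈ hitSet Y g t := by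
  refine ⟨fun h => exists_le_of_forall_exists_lt hy hg hgc fun ε hε => ?_,
    iInf_le_zero_of_mem_hitSet⟩
  have : (⨅ s ∈ Iic t, ((Y s ω - g s : ℝ) : EReal)) < (ε : EReal) :=
    h.trans_lt (by exact_mod_cast hε)
  simp only [iInf_lt_iff] at this
  obtain ⟨u, hu, hlt⟩ := this
  exact ⟨u, hu, by exact_mod_cast hlt⟩

end HittingSets

/-! ### Measurability of the hitting and crossing events -/

section Measurability

variable {Ω : Type*} {mΩ : MeasurableSpace Ω} {P : Measure Ω} {𝓕 : Filtration ℝ≥0 mΩ}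
  {Y : ℝ≥0 → Ω → ℝ} {g : ℝ≥0 → ℝ}

theorem nullMeasurableSet_of_eventuallyMeasurableSet {t : ℝ≥0} {A : Set Ω}
    (hA : EventuallyMeasurableSet (𝓕 t) (ae P) A) : NullMeasurableSet A P := by
  obtain ⟨A', hA', h⟩ := hA
  exact (𝓕.le t _ hA').nullMeasurableSet.congr h.symm

/-- A hit before `t` is approximated at rational times to its right, where the barrier is no lower;
capping at `t` supplies `t` itself. Null sets enter because paths are continuous only almost surely
and `𝓕` need not be complete. -/
theorem eventuallyMeasurableSet_hitSet (hYm : ∀ t, Measurable[𝓕 t] (Y t))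
    (hYc : ∀ᵐ ω ∂P, Continuous fun t => Y t ω) (hg : Monotone g)
    (hgc : ∀ t, ContinuousWithinAt g (Ici t) t) (t : ℝ≥0) :
    EventuallyMeasurableSet (𝓕 t) (ae P) (hitSet Y g t) := by
  refine ⟨⋂ m : ℕ, ⋃ q : ℚ, {ω | Y (min (Real.toNNReal q) t) ω <
    g (min (Real.toNNReal q) t) + 1 / ((m : ℝ) + 1)}, ?_, ?_⟩
  · refine MeasurableSet.iInter fun m => MeasurableSet.iUnion fun q => ?_
    exact ((hYm _).mono (𝓕.mono (min_le_right _ _)) le_rfl) measurableSet_Iio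
  · rw [Filter.eventuallyEq_set]
    filter_upwards [hYc] with ω hω
    simp only [mem_iInter, mem_iUnion, mem_ofPred_eq]
    constructor
    · rintro ⟨u, hu, hle⟩ m
      have hpos : (0 : ℝ) < 1 / ((m : ℝ) + 1) := by positivity
      rcases hu.eq_or_lt with rfl | hlt
      · obtain ⟨q, hq⟩ := exists_rat_gt (u : ℝ)
        refine ⟨q, ?_⟩
        rw [min_eq_right (by rw [← NNReal.coe_le_coe]; exact hq.le.trans (Real.le_coe_toNNReal _))]
        linarith
      · have h1 : ∀ᶠ v in 𝓝 u, Y v ω < Y u ω + 1 / ((m : ℝ) + 1) :=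
          hω.continuousAt.eventually (gt_mem_nhds (by linarith))
        obtain ⟨r, hr, hsub⟩ := exists_Ico_subset_of_mem_nhds h1 ⟨t, hlt⟩
        obtain ⟨q, huq, hqr⟩ := exists_rat_btwn
          (show (u : ℝ) < ((min r t : ℝ≥0) : ℝ) from NNReal.coe_lt_coe.2 (lt_min hr hlt))
        have hq0 : (0 : ℝ) ≤ q := u.2.trans huq.le
        have hqr' : Real.toNNReal q < min r t := by
          rw [← NNReal.coe_lt_coe, Real.coe_toNNReal _ hq0]; exact hqr
        have huq' : u ≤ Real.toNNReal q := by
          rw [← NNReal.coe_le_coe, Real.coe_toNNReal _ hq0]; exact huq.le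
        refine ⟨q, ?_⟩
        rw [min_eq_left (hqr'.le.trans (min_le_right _ _))]
        have h2 : Y (Real.toNNReal q) ω < Y u ω + 1 / ((m : ℝ) + 1) :=
          hsub ⟨huq', hqr'.trans_le (min_le_left _ _)⟩
        have h3 := hg huq'
        linarith
    · intro h
      refine exists_le_of_forall_exists_lt hω hg hgc fun ε hε => ?_
      obtain ⟨m, hm⟩ := exists_nat_one_div_lt hε
      obtain ⟨q, hq⟩ := h m
      exact ⟨_, min_le_right _ t, by linarith⟩

/-- For a fixed `w`, strict inequality is open in time, so `v` can be moved to a slightly earlier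
rational. The uncountable union over `w` is harmless, being a union of open half-lines. -/
theorem eventuallyMeasurableSet_crossSet (hYm : ∀ t, Measurable[𝓕 t] (Y t))
    (hYc : ∀ᵐ ω ∂P, Continuous fun t => Y t ω) (t : ℝ≥0) :
    EventuallyMeasurableSet (𝓕 t) (ae P) (crossSet Y g t) := by
  refine ⟨⋃ q : ℚ, Y (min (Real.toNNReal q) t) ⁻¹'
    ⋃ w : Iio (min (Real.toNNReal q) t), Iio (g w), ?_, ?_⟩
  · refine MeasurableSet.iUnion fun q => ?_
    exact ((hYm _).mono (𝓕.mono (min_le_right _ _)) le_rfl)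
      (isOpen_iUnion fun w => isOpen_Iio).measurableSet
  · rw [Filter.eventuallyEq_set]
    filter_upwards [hYc] with ω hω
    simp only [mem_iUnion, mem_preimage, mem_Iio, Subtype.exists, exists_prop]
    constructor
    · rintro ⟨v, hv, w, hw, hlt⟩
      have h1 : ∀ᶠ x in 𝓝 v, Y x ω < g w := hω.continuousAt.eventually (gt_mem_nhds hlt)
      obtain ⟨r, hr, hsub⟩ := exists_Ioc_subset_of_mem_nhds h1 ⟨w, hw⟩
      obtain ⟨q, huq, hqr⟩ := exists_rat_btwn
        (show ((max r w : ℝ≥0) : ℝ) < v from NNReal.coe_lt_coe.2 (max_lt hr hw))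
      have hq0 : (0 : ℝ) ≤ q := (NNReal.coe_nonneg _).trans huq.le
      have hqv : Real.toNNReal q < v := by
        rw [← NNReal.coe_lt_coe, Real.coe_toNNReal _ hq0]; exact hqr
      have huq' : max r w < Real.toNNReal q := by
        rw [← NNReal.coe_lt_coe, Real.coe_toNNReal _ hq0]; exact huq
      refine ⟨q, w, ?_⟩
      rw [min_eq_left (hqv.le.trans hv)]
      exact ⟨(le_max_right _ _).trans_lt huq', hsub ⟨(le_max_left _ _).trans_lt huq', hqv.le⟩⟩
    · rintro ⟨q, w, hw, hlt⟩
      exact ⟨_, min_le_right _ _, w, hw, hlt⟩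

end Measurability

/-! ### Immediate crossing after a hit -/

section Crossing

variable {Ω : Type*} {mΩ : MeasurableSpace Ω} {P : Measure Ω}
  {𝓕 : Filtration ℝ≥0 mΩ} {B Y : ℝ≥0 → Ω → ℝ} {g : ℝ≥0 → ℝ} {c : ℝ}

theorem gaussianReal_Ici_lt_one (a : ℝ) : gaussianReal 0 1 (Ici a) < 1 := by
  refine lt_of_le_of_ne prob_le_one fun h => ?_
  have h0 : gaussianReal 0 1 (Iio a) = 0 := by
    rw [← compl_Ici]
    exact (prob_compl_eq_zero_iff measurableSet_Ici).2 h
  simpa using gaussianReal_absolutelyContinuous' 0 one_ne_zero h0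

/-- An upper bound, uniform in `h ≤ 1`, for the probability that a Brownian increment over a time
`h` exceeds `-c h - √h`. -/
theorem IsBrownianWrt.measure_increment_le (hB : IsBrownianWrt B 𝓕 P) (hc : 0 ≤ c) {t h : ℝ≥0}
    (h0 : 0 < h) (h1 : h ≤ 1) :
    P {ω | -c * h - √h ≤ B (t + h) ω - B t ω} ≤ gaussianReal 0 1 (Ici (-c - 1)) := by
  have hlaw := hB.isBrownian.hasLaw_sub (t + h) t
  have hvar : nndist (t + h).1 t.1 = h := by
    apply NNReal.coe_injective
    rw [coe_nndist, Real.dist_eq]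
    change |((t + h : ℝ≥0) : ℝ) - t| = h
    simp
  rw [hvar] at hlaw
  have hset : {ω | -c * h - √h ≤ B (t + h) ω - B t ω}
      = (B (t + h) - B t) ⁻¹' Ici (-c * h - √h) := rfl
  have hsq : √(h : ℝ) * √h = h := Real.mul_self_sqrt h.2
  have hpos : 0 < √(h : ℝ) := Real.sqrt_pos.2 h0
  have hle : √(h : ℝ) ≤ 1 := Real.sqrt_le_one.2 h1
  have hmap : gaussianReal 0 h = (gaussianReal 0 1).map (√(h : ℝ) * ·) := by
    rw [gaussianReal_map_const_mul]
    congr 1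
    · simp
    · apply NNReal.coe_injective
      simp
  rw [hset, ← Measure.map_apply_of_aemeasurable hlaw.aemeasurable measurableSet_Ici, hlaw.map_eq,
    hmap, Measure.map_apply (by fun_prop) measurableSet_Ici]
  refine measure_mono fun x hx => ?_
  have hx' : -c * h - √h ≤ √(h : ℝ) * x := hx
  have h3 : √(h : ℝ) * (-c * √h - 1) ≤ √(h : ℝ) * x := by
    calc √(h : ℝ) * (-c * √h - 1) = -c * (√(h : ℝ) * √h) - √h := by ring
      _ ≤ _ := by rw [hsq]; exact hx'
  have h4 := le_of_mul_le_mul_left h3 hpos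
  -- Here `h ≤ 1` makes the bound uniform: after division by `√h` the drift costs at most `c`.
  have h5 : c * √(h : ℝ) ≤ c * 1 := mul_le_mul_of_nonneg_left hle hc
  change -c - 1 ≤ x
  linarith

theorem IsBrownianWrt.measure_inter_increment_le (hB : IsBrownianWrt B 𝓕 P) (hc : 0 ≤ c)
    {t h : ℝ≥0} (h0 : 0 < h) (h1 : h ≤ 1) {A : Set Ω}
    (hA : EventuallyMeasurableSet (𝓕 t) (ae P) A) :
    P (A ∩ {ω | -c * h - √h ≤ B (t + h) ω - B t ω}) ≤
      gaussianReal 0 1 (Ici (-c - 1)) * P A := by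
  obtain ⟨A', hA', hAA'⟩ := hA
  have hind := (Indep_iff _ _ _).1 (hB.indep t (t + h) le_self_add)
    {ω | -c * h - √h ≤ B (t + h) ω - B t ω} A' ⟨Ici (-c * h - √h), measurableSet_Ici, rfl⟩ hA'
  have h2 := measure_congr (ae_eq_set_inter hAA'
    (ae_eq_refl {ω | -c * h - √h ≤ B (t + h) ω - B t ω}))
  rw [h2, inter_comm, hind, measure_congr hAA']
  gcongr
  exact hB.measure_increment_le hc h0 h1

theorem EventuallyMeasurableSet.mono {s t : ℝ≥0} {A : Set Ω} {l : Filter Ω}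
    [CountableInterFilter l] (hA : EventuallyMeasurableSet (𝓕 s) l A) (hst : s ≤ t) :
    EventuallyMeasurableSet (𝓕 t) l A := by
  obtain ⟨A', hA', h⟩ := hA
  exact ⟨A', 𝓕.mono hst _ hA', h⟩

/-- The event that the barrier is reached before time `s`, without the process falling strictly
below an earlier value of the barrier in the following time span `h`. -/
def touchSet (Y : ℝ≥0 → Ω → ℝ) (g : ℝ≥0 → ℝ) (s h : ℝ≥0) : Set Ω :=
  {ω | ∃ t ≤ s, ω ∈ hitSet Y g t ∧ ω ∉ crossSet Y g (t + h)}

theorem touchSet_anti (Y : ℝ≥0 → Ω → ℝ) (g : ℝ≥0 → ℝ) (s : ℝ≥0) : Antitone (touchSet Y g s) :=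
  fun _ _ hh _ ⟨t, ht, h1, h2⟩ =>
    ⟨t, ht, h1, fun h => h2 (crossSet_mono Y g (add_le_add_right hh t) h)⟩

/-- Paths whose oscillation over times at most `d` apart, up to time `s`, is at most `e`. -/
def oscSet (Y : ℝ≥0 → Ω → ℝ) (s : ℝ≥0) (d e : ℝ) : Set Ω :=
  {ω | ∀ u ≤ s, ∀ v ≤ s, dist u v ≤ d → Y v ω ≤ Y u ω + e}

theorem exists_mem_oscSet {ω : Ω} (hω : Continuous fun t => Y t ω) (s : ℝ≥0) {e : ℝ}
    (he : 0 < e) : ∃ d > 0, ω ∈ oscSet Y s d e := by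
  have h := isCompact_Icc.uniformContinuousOn_of_continuous (s := Icc 0 s) hω.continuousOn
  rw [Metric.uniformContinuousOn_iff] at h
  obtain ⟨d, hd, h⟩ := h e he
  refine ⟨d / 2, by positivity, fun u hu v hv huv => ?_⟩
  have := h v ⟨bot_le, hv⟩ u ⟨bot_le, hu⟩ (by rw [dist_comm]; linarith)
  rw [Real.dist_eq] at this
  linarith [(abs_lt.1 this).2]

/-- The pathwise estimate on the grid with mesh `d`. -/
theorem touchSet_inter_subset (n : ℕ) {d h : ℝ≥0} (hdh : 2 * d ≤ h)
    {ω : Ω} (hdrift : ∀ u v, u ≤ v → Y v ω - Y u ω ≤ c * (v - u) + (B v ω - B u ω))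
    (h0 : 0 < h) (hω : ω ∈ touchSet Y g (n * d) (2 * h))
    (hosc : ω ∈ oscSet Y (n * d + d) (2 * d) (√h)) :
    ∃ k ∈ Finset.range (n + 1),
      ω ∈ (disjointed (fun k : ℕ => hitSet Y g (k * d)) k \ crossSet Y g (k * d + d)) ∩
        {ω | -c * h - √h ≤ B (k * d + d + h) ω - B (k * d + d) ω} := by
  classical
  obtain ⟨t, hts, hht, hct⟩ := hω
  have hex : ∃ k : ℕ, ω ∈ hitSet Y g (k * d) := ⟨n, hitSet_mono Y g hts hht⟩
  -- The grid time `k * d` replaces the hitting time: some hit precedes it, and none occurs up to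
  -- the previous grid point.
  set k := Nat.find hex with hk
  have hkn : k ≤ n := Nat.find_min' hex (hitSet_mono Y g hts hht)
  have hkh : ω ∈ hitSet Y g (k * d) := Nat.find_spec hex
  have hmin : ∀ j < k, ω ∉ hitSet Y g (j * d) := fun j hj => Nat.find_min hex hj
  have hkt : (k : ℝ≥0) * d ≤ t + d := by
    rcases Nat.eq_zero_or_pos k with h | h
    · simp [h]
    · obtain ⟨j, hj⟩ : ∃ j, k = j + 1 := ⟨k - 1, by omega⟩
      have := hmin j (by omega)
      have hjt : (j : ℝ≥0) * d < t := by
        by_contra! hle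
        exact this (hitSet_mono Y g hle hht)
      rw [hj]
      push_cast
      rw [add_mul, one_mul]
      gcongr
  -- The span `2 * h` without crossing pays for a delay of at most two meshes and for the increment
  -- of length `h`.
  have hcross : ∀ v ≤ (k : ℝ≥0) * d + d + h, ω ∉ crossSet Y g v := fun v hv hmem => by
    refine hct (crossSet_mono Y g (hv.trans ?_) hmem)
    calc (k : ℝ≥0) * d + d + h ≤ t + d + d + h := by gcongr
      _ = t + (2 * d + h) := by ring
      _ ≤ t + (h + h) := by gcongr
      _ = t + 2 * h := by ring
  refine ⟨k, Finset.mem_range.2 (by omega), ⟨⟨?_, hcross _ le_self_add⟩, ?_⟩⟩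
  · rw [disjointed_apply]
    refine ⟨hkh, ?_⟩
    simpa using fun j hj => hmin j hj
  · change -c * h - √h ≤ _
    -- A smaller increment outweighs the drift `c * h` and the oscillation `√h` since the hit at
    -- `u`, so it would push the path strictly below `g u`.
    by_contra! hlt
    obtain ⟨u, hu, hYu⟩ := hkh
    have hku : (k : ℝ≥0) * d ≤ u + d := by
      rcases Nat.eq_zero_or_pos k with h | h
      · simp [h]
      · obtain ⟨j, hj⟩ : ∃ j, k = j + 1 := ⟨k - 1, by omega⟩
        have := hmin j (by omega)
        have hjt : (j : ℝ≥0) * d < u := by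
          by_contra! hle
          exact this ⟨u, hle, hYu⟩
        rw [hj]
        push_cast
        rw [add_mul, one_mul]
        gcongr
    have hknd : (k : ℝ≥0) * d ≤ n * d := by gcongr
    have hd1 : dist u (k * d + d) ≤ 2 * d := by
      rw [NNReal.dist_eq, abs_le]
      have h1 : ((k : ℝ) * d) ≤ u + d := by exact_mod_cast hku
      have h2 : (u : ℝ) ≤ k * d := by exact_mod_cast hu
      have h3 : (0 : ℝ) ≤ d := d.2
      push_cast
      constructor <;> linarith
    have ho := hosc u ((hu.trans hknd).trans le_self_add) (k * d + d) (by gcongr) hd1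
    have hdr := hdrift (k * d + d) (k * d + d + h) le_self_add
    have hh : c * (((k * d + d + h : ℝ≥0) : ℝ) - ((k * d + d : ℝ≥0) : ℝ)) = c * h := by
      push_cast; ring
    rw [hh] at hdr
    refine hcross _ le_rfl ⟨_, le_rfl, u, ?_, ?_⟩
    · exact (hu.trans le_self_add).trans_lt (lt_add_of_pos_right _ h0)
    · linarith

/-- The events of first hitting by the grid time `k * d` without crossing by `k * d + d` are
disjoint and known at `k * d + d`. Each contributes the factor `q` by independence, and their union
consists of paths that touch without crossing for a time `d`. -/
theorem measure_touchSet_le [IsProbabilityMeasure P] (hB : IsBrownianWrt B 𝓕 P)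
    (hYm : ∀ t, Measurable[𝓕 t] (Y t)) (hYc : ∀ᵐ ω ∂P, Continuous fun t => Y t ω)
    (hc : 0 ≤ c)
    (hdrift : ∀ᵐ ω ∂P, ∀ u v, u ≤ v → Y v ω - Y u ω ≤ c * (v - u) + (B v ω - B u ω))
    (hg : Monotone g) (hgc : ∀ t, ContinuousWithinAt g (Ici t) t)
    {n : ℕ} {d h : ℝ≥0} (hd : 0 < d) (hdh : 2 * d ≤ h) (h1 : h ≤ 1) :
    P (touchSet Y g (n * d) (2 * h) ∩ oscSet Y (n * d + d) (2 * d) (√h)) ≤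
      gaussianReal 0 1 (Ici (-c - 1)) * P (⋃ e > 0, touchSet Y g (n * d) e) := by
  have h0 : 0 < h := lt_of_lt_of_le (by positivity) hdh
  set A : ℕ → Set Ω :=
    fun k => disjointed (fun k : ℕ => hitSet Y g (k * d)) k \ crossSet Y g (k * d + d) with hAdef
  have hAm : ∀ k : ℕ, EventuallyMeasurableSet (𝓕 (k * d + d)) (ae P) (A k) := by
    intro k
    refine MeasurableSet.diff ?_ (eventuallyMeasurableSet_crossSet hYm hYc _)
    rw [disjointed_apply]
    refine MeasurableSet.diff ?_ ?_
    · exact (eventuallyMeasurableSet_hitSet hYm hYc hg hgc _).mono le_self_add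
    · rw [Finset.sup_set_eq_biUnion]
      refine Finset.measurableSet_biUnion _ fun j hj => ?_
      have hjk : (j : ℝ≥0) ≤ k := by exact_mod_cast (Finset.mem_Iio.1 hj).le
      exact (eventuallyMeasurableSet_hitSet hYm hYc hg hgc _).mono
        ((mul_le_mul_left hjk d).trans le_self_add)
  have hdisj : Pairwise (Function.onFun (AEDisjoint P) A) := fun i j hij =>
    ((disjoint_disjointed _ hij).mono sdiff_subset sdiff_subset).aedisjoint
  calc P (touchSet Y g (n * d) (2 * h) ∩ oscSet Y (n * d + d) (2 * d) (√h))
      ≤ P (⋃ k ∈ Finset.range (n + 1),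
          A k ∩ {ω | -c * h - √h ≤ B (k * d + d + h) ω - B (k * d + d) ω}) := by
        refine measure_mono_ae ?_
        filter_upwards [hdrift] with ω hω hmem
        obtain ⟨k, hk, hmem'⟩ := touchSet_inter_subset n hdh hω h0 hmem.1 hmem.2
        exact mem_biUnion hk hmem'
    _ ≤ ∑ k ∈ Finset.range (n + 1),
          P (A k ∩ {ω | -c * h - √h ≤ B (k * d + d + h) ω - B (k * d + d) ω}) :=
        measure_biUnion_finset_le _ _
    _ ≤ ∑ k ∈ Finset.range (n + 1), gaussianReal 0 1 (Ici (-c - 1)) * P (A k) :=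
        Finset.sum_le_sum fun k _ => hB.measure_inter_increment_le hc h0 h1 (hAm k)
    _ = gaussianReal 0 1 (Ici (-c - 1)) * P (⋃ k ∈ Finset.range (n + 1), A k) := by
        rw [← Finset.mul_sum, measure_biUnion_finset₀ (fun i _ j _ hij => hdisj hij)
          fun k _ => nullMeasurableSet_of_eventuallyMeasurableSet (hAm k)]
    _ ≤ _ := by
        gcongr
        refine iUnion₂_subset fun k hk ω hω => ?_
        refine mem_iUnion₂.2 ⟨d, hd, k * d, ?_, 
          disjointed_subset (fun k : ℕ => hitSet Y g (k * d)) _ hω.1, hω.2⟩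
        have := Finset.mem_range.1 hk
        gcongr
        omega

/-- Almost surely, a process driven by a Brownian motion with drift bounded above crosses an
increasing barrier immediately after it reaches it. -/
theorem measure_hitSet_diff_crossSet [IsProbabilityMeasure P] (hB : IsBrownianWrt B 𝓕 P)
    (hYm : ∀ t, Measurable[𝓕 t] (Y t)) (hYc : ∀ᵐ ω ∂P, Continuous fun t => Y t ω)
    (hc : 0 ≤ c)
    (hdrift : ∀ᵐ ω ∂P, ∀ u v, u ≤ v → Y v ω - Y u ω ≤ c * (v - u) + (B v ω - B u ω))
    (hg : Monotone g) (hgc : ∀ t, ContinuousWithinAt g (Ici t) t) {s r : ℝ≥0} (hsr : s < r) :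
    P (hitSet Y g s \ crossSet Y g r) = 0 := by
  -- A positive horizon `s'` gives nonzero meshes even when `s = 0`, and leaves the span `r - s'`
  -- free of crossings.
  obtain ⟨s', hss', hs'r⟩ := exists_between hsr
  have hs' : 0 < s' := bot_le.trans_lt hss'
  set q := gaussianReal 0 1 (Ici (-c - 1)) with hq
  have hq1 : q < 1 := gaussianReal_Ici_lt_one _
  set N := ⋃ e > 0, touchSet Y g s' e with hN
  have key : ∀ h : ℝ≥0, 0 < h → h ≤ 1 → P (touchSet Y g s' (2 * h)) ≤ q * P N := by
    intro h h0 h1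
    set D : ℕ → ℝ≥0 := fun n => s' / ((n : ℝ≥0) + 1) with hD
    have hDlim : Tendsto (fun n => 2 * D n) atTop (𝓝 0) := by
      rw [← NNReal.tendsto_coe]
      have := (tendsto_one_div_add_atTop_nhds_zero_nat (𝕜 := ℝ)).const_mul (2 * (s' : ℝ))
      rw [mul_zero] at this
      refine this.congr fun n => ?_
      simp only [hD]
      push_cast
      ring
    have hDanti : Antitone D := by
      intro m n hmn
      simp only [hD]
      gcongr
    -- Uniform continuity makes these sets exhaust the touch set up to a null set, while the bound
    -- `q * P N` does not depend on the mesh.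
    set U : ℕ → Set Ω := fun m => touchSet Y g s' (2 * h) ∩
      {ω | ∀ n ≥ m, ω ∈ oscSet Y (s' + D n) (2 * D n) (√h)} with hU
    have hUmono : Monotone U := fun m n hmn ω hω => ⟨hω.1, fun k hk => hω.2 k (hmn.trans hk)⟩
    calc P (touchSet Y g s' (2 * h)) ≤ P (⋃ m, U m) := by
          refine measure_mono_ae ?_
          filter_upwards [hYc] with ω hω hmem
          obtain ⟨e, he, hosc⟩ := exists_mem_oscSet hω (2 * s') (Real.sqrt_pos.2 h0)
          have hev : ∀ᶠ n in atTop, 2 * D n < e.toNNReal :=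
            hDlim.eventually (gt_mem_nhds (Real.toNNReal_pos.2 he))
          obtain ⟨m, hm⟩ := eventually_atTop.1 hev
          refine mem_iUnion.2 ⟨m, hmem, fun n hn u hu v hv huv => ?_⟩
          have hDn : s' + D n ≤ 2 * s' := by
            have : D n ≤ s' := div_le_self bot_le (by simp)
            rw [two_mul]
            gcongr
          refine hosc u (hu.trans hDn) v (hv.trans hDn) (huv.trans ?_)
          have h2 := (Real.lt_toNNReal_iff_coe_lt).1 (hm n hn)
          exact_mod_cast h2.le
      _ = ⨆ m, P (U m) := hUmono.measure_iUnion
      _ ≤ q * P N := by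
          refine iSup_le fun m => ?_
          have hev : ∀ᶠ n in atTop, 2 * D n < h := hDlim.eventually (gt_mem_nhds h0)
          obtain ⟨n, hn, hmn⟩ := (hev.and (eventually_ge_atTop m)).exists
          have hnd : ((n + 1 : ℕ) : ℝ≥0) * D n = s' := by
            simp only [hD]
            push_cast
            field_simp
          have := measure_touchSet_le hB hYm hYc hc hdrift hg hgc (n := n + 1) (d := D n)
            (h := h) (by positivity) hn.le h1
          rw [hnd] at this
          have hsub : U m ⊆ touchSet Y g s' (2 * h) ∩ oscSet Y (s' + D n) (2 * D n) (√h) :=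
            fun ω hω => ⟨hω.1, hω.2 n hmn⟩
          exact (measure_mono hsub).trans this
  have hNle : P N ≤ q * P N := by
    have hNeq : N ⊆ ⋃ m : ℕ, touchSet Y g s' (2 * (1 / ((m : ℝ≥0) + 1))) := by
      refine iUnion₂_subset fun e he ω hω => ?_
      obtain ⟨m, hm⟩ := exists_nat_one_div_lt (K := ℝ≥0) (half_pos he)
      refine mem_iUnion.2 ⟨m, touchSet_anti Y g s' ?_ hω⟩
      calc 2 * (1 / ((m : ℝ≥0) + 1)) ≤ 2 * (e / 2) := by gcongr
        _ = e := by field_simp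
    refine (measure_mono hNeq).trans ?_
    rw [Monotone.measure_iUnion]
    · refine iSup_le fun m => key _ (by positivity) ?_
      rw [div_le_one (by positivity)]
      simp
    · intro m n hmn
      apply touchSet_anti
      gcongr
  have hN0 : P N = 0 := by
    by_contra h0
    have : q * P N < 1 * P N := ENNReal.mul_lt_mul_left h0 (measure_ne_top _ _) hq1
    rw [one_mul] at this
    exact absurd hNle (not_le.2 this)
  refine measure_mono_null (fun ω hω => ?_) hN0
  refine mem_iUnion₂.2 ⟨r - s', tsub_pos_of_lt hs'r, s', le_rfl, hitSet_mono Y g hss'.le hω.1, ?_⟩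
  rw [add_tsub_cancel_of_le hs'r.le]
  exact hω.2

end Crossing

/-! ### Order and weak convergence in `M` -/

namespace ExtCDF

/-- An element of `M` from an increasing right-continuous function. -/
def ofMonotone (f : EReal → ℝ) (h01 : ∀ t, f t ∈ Icc (0 : ℝ) 1) (hf : Monotone f)
    (hrc : ∀ t, ContinuousWithinAt f (Ici t) t) (h0 : ∀ t < 0, f t = 0) (htop : f ⊤ = 1) :
    ExtCDF where
  toFun := f
  mem_Icc := h01
  cadlag t := ⟨hrc t, _, hf.tendsto_nhdsLT t⟩
  mono := hf
  zero_left := tendsto_const_nhds.congr' (by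
    filter_upwards [self_mem_nhdsWithin] with s hs using (h0 s hs).symm)
  top_eq := htop

theorem zero_le (ℓ : ExtCDF) (t : EReal) : zero t ≤ ℓ t := by
  by_cases h : t = ⊤
  · rw [h, ℓ.top_eq, zero.top_eq]
  · have h0 : zero t = 0 := by
      change indicator {⊤} (fun _ => (1 : ℝ)) t = 0
      simp [h]
    exact h0.trans_le (ℓ.mem_Icc t).1

theorem eventually_lt (ℓ : ExtCDF) {t : EReal} {c : ℝ} (h : ℓ t < c) :
    ∀ᶠ ℓ' : ExtCDF in 𝓝 ℓ, ℓ' t < c :=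
  IsOpen.mem_nhds (TopologicalSpace.isOpen_generateFrom_of_mem (Or.inl ⟨t, c, rfl⟩)) h

theorem eventually_gt (ℓ : ExtCDF) {s t : EReal} {c : ℝ} (hst : s < t) (h : c < ℓ s) :
    ∀ᶠ ℓ' : ExtCDF in 𝓝 ℓ, c < ℓ' t := by
  have : {ℓ' : ExtCDF | ∃ s < t, c < ℓ' s} ∈ 𝓝 ℓ :=
    IsOpen.mem_nhds (TopologicalSpace.isOpen_generateFrom_of_mem (Or.inr ⟨t, c, rfl⟩)) ⟨s, hst, h⟩
  filter_upwards [this] with ℓ' ⟨r, hr, hc⟩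
  exact hc.trans_le (ℓ'.mono hr.le)

theorem tendsto_of_eventually {ι : Type*} {F : Filter ι} {u : ι → ExtCDF} {ℓ : ExtCDF}
    (hlt : ∀ t c, ℓ t < c → ∀ᶠ i in F, u i t < c)
    (hgt : ∀ s t c, s < t → c < ℓ s → ∀ᶠ i in F, c < u i t) : Tendsto u F (𝓝 ℓ) := by
  rw [TopologicalSpace.tendsto_nhds_generateFrom_iff]
  rintro U (⟨t, c, rfl⟩ | ⟨t, c, rfl⟩) hU
  · exact hlt t c hU
  · obtain ⟨s, hst, hs⟩ := hU
    obtain ⟨r, hsr, hrt⟩ := exists_between hst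
    filter_upwards [hgt s r c hsr hs] with i hi
    exact ⟨r, hrt, hi⟩

/-- Two elements of `M` are ordered as soon as the first at any time lies below the second at
any later time. -/
theorem le_of_forall_lt {ℓ ℓ' : ExtCDF} (h : ∀ s t, s < t → ℓ s ≤ ℓ' t) (t : EReal) :
    ℓ t ≤ ℓ' t := by
  rcases eq_or_ne t ⊤ with rfl | ht
  · rw [ℓ.top_eq, ℓ'.top_eq]
  · have : (𝓝[>] t).NeBot := nhdsGT_neBot_of_exists_gt ⟨⊤, lt_top_iff_ne_top.2 ht⟩
    refine ge_of_tendsto ((ℓ'.cadlag t).1.mono Ioi_subset_Ici_self) ?_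
    filter_upwards [self_mem_nhdsWithin] with s hs using h t s hs

/-- The subbasic open sets compare values only across times `s < t`; right-continuity then gives
equality. -/
theorem tendsto_unique {ι : Type*} {F : Filter ι} [F.NeBot] {u : ι → ExtCDF} {ℓ ℓ' : ExtCDF}
    (h : Tendsto u F (𝓝 ℓ)) (h' : Tendsto u F (𝓝 ℓ')) : ℓ = ℓ' := by
  have key : ∀ {a b : ExtCDF}, Tendsto u F (𝓝 a) → Tendsto u F (𝓝 b) → ∀ t, a t ≤ b t := by
    intro a b ha hb
    refine le_of_forall_lt fun s t hst => ?_
    by_contra! hlt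
    obtain ⟨c, hc1, hc2⟩ := exists_between hlt
    obtain ⟨i, hi1, hi2⟩ :=
      ((ha.eventually (a.eventually_gt hst hc2)).and (hb.eventually (b.eventually_lt hc1))).exists
    exact lt_asymm hi1 hi2
  exact ExtCDF.ext (funext fun t => le_antisymm (key h h' t) (key h' h t))

/-- The limit of a sequence in `M` inherits bounds at later times. -/
theorem le_of_tendsto_of_lt {ι : Type*} {F : Filter ι} [F.NeBot] {u : ι → ExtCDF} {ℓ : ExtCDF}
    (h : Tendsto u F (𝓝 ℓ)) {s t : EReal} (hst : s < t) {c : ℝ} (hc : ∀ i, u i t ≤ c) :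
    ℓ s ≤ c := by
  by_contra! hlt
  obtain ⟨i, hi⟩ := (h.eventually (ℓ.eventually_gt hst hlt)).exists
  exact absurd (hc i) (not_le.2 hi)

/-- An increasing sequence in `M` converges. -/
theorem exists_tendsto_of_monotone {u : ℕ → ExtCDF} (hu : ∀ t, Monotone fun k => u k t) :
    ∃ ℓ, Tendsto u atTop (𝓝 ℓ) := by
  -- The pointwise supremum need not be right-continuous. Its right limit is the candidate, and the
  -- weak topology does not see the difference.
  set f : EReal → ℝ := fun t => ⨆ k, u k t with hf
  have hbdd : ∀ t, BddAbove (range fun k => u k t) := fun t =>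
    ⟨1, by rintro _ ⟨k, rfl⟩; exact ((u k).mem_Icc t).2⟩
  have hfm : Monotone f := fun s t hst => ciSup_mono (hbdd t) fun k => (u k).mono hst
  have h0f : ∀ t, 0 ≤ f t := fun t => ((u 0).mem_Icc t).1.trans (le_ciSup (hbdd t) 0)
  have hf1 : ∀ t, f t ≤ 1 := fun t => ciSup_le fun k => ((u k).mem_Icc t).2
  have htop : f ⊤ = 1 := by simp [hf, top_eq]
  have hrt : f.rightLim ⊤ = 1 := by rw [rightLim_eq_of_isTop isTop_top, htop]
  let ℓ : ExtCDF := ofMonotone f.rightLim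
    (fun t => ⟨(h0f t).trans (hfm.le_rightLim le_rfl),
      (hfm.rightLim le_top).trans_eq hrt⟩) hfm.rightLim
    (fun t => continuousWithinAt_rightLim_Ici (hfm.tendsto_rightLim t))
    (fun t ht => by
      obtain ⟨r, htr, hr0⟩ := exists_between ht
      refine le_antisymm ((hfm.rightLim_le htr).trans ?_) ((h0f t).trans (hfm.le_rightLim le_rfl))
      exact ciSup_le fun k => ((u k).eq_zero_of_neg hr0).le)
    hrt
  refine ⟨ℓ, tendsto_of_eventually (fun t c h => ?_) fun s t c hst hc => ?_⟩
  · refine Eventually.of_forall fun k => ?_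
    exact ((le_ciSup (hbdd t) k).trans (hfm.le_rightLim le_rfl)).trans_lt h
  · have : c < f t := lt_of_lt_of_le hc (hfm.rightLim_le hst)
    obtain ⟨k, hk⟩ := exists_lt_of_lt_ciSup this
    filter_upwards [eventually_ge_atTop k] with j hj
    exact hk.trans_le (hu t hj)

/-- Monotonicity reduces a bound at all times to finitely many grid times: round `u` up to a
multiple of `ε`. -/
theorem eventually_forall_lt_add (ℓ : ExtCDF) (t : ℝ≥0) {ε : ℝ} (hε : 0 < ε) :
    ∀ᶠ ℓ' : ExtCDF in 𝓝 ℓ, ∀ u ≤ t, ℓ' ((u : ℝ) : EReal) ≤ ℓ (((u : ℝ) + ε : ℝ) : EReal) + ε := by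
  have : ∀ᶠ ℓ' : ExtCDF in 𝓝 ℓ, ∀ k ∈ Finset.range (⌈(t : ℝ) / ε⌉₊ + 1),
      ℓ' ((k * ε : ℝ) : EReal) < ℓ ((k * ε : ℝ) : EReal) + ε :=
    (Finset.eventually_all _).2 fun k _ => ℓ.eventually_lt (by linarith)
  filter_upwards [this] with ℓ' h u hu
  have hk : ⌈(u : ℝ) / ε⌉₊ ≤ ⌈(t : ℝ) / ε⌉₊ := Nat.ceil_mono (by gcongr)
  have h1 : (u : ℝ) ≤ ⌈(u : ℝ) / ε⌉₊ * ε := (div_le_iff₀ hε).1 (Nat.le_ceil _)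
  have h2 : ⌈(u : ℝ) / ε⌉₊ * ε ≤ u + ε := by
    have := (Nat.ceil_lt_add_one (div_nonneg u.2 hε.le)).le
    calc ⌈(u : ℝ) / ε⌉₊ * ε ≤ ((u : ℝ) / ε + 1) * ε := by gcongr; exact this
      _ = u + ε := by field_simp
  calc ℓ' ((u : ℝ) : EReal) ≤ ℓ' ((⌈(u : ℝ) / ε⌉₊ * ε : ℝ) : EReal) :=
        ℓ'.mono (EReal.coe_le_coe_iff.2 h1)
    _ ≤ ℓ ((⌈(u : ℝ) / ε⌉₊ * ε : ℝ) : EReal) + ε := (h _ (Finset.mem_range.2 (by omega))).le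
    _ ≤ _ := by
      gcongr
      exact ℓ.mono (EReal.coe_le_coe_iff.2 h2)

/-- The shift is `2 * ε` because one `ε` is lost in rounding `u` down, and another because weak
convergence gives lower bounds only through strictly earlier values of the limit. -/
theorem eventually_forall_sub_lt (ℓ : ExtCDF) (t : ℝ≥0) {ε : ℝ} (hε : 0 < ε) :
    ∀ᶠ ℓ' : ExtCDF in 𝓝 ℓ, ∀ u ≤ t,
      ℓ (((u : ℝ) - 2 * ε : ℝ) : EReal) - ε ≤ ℓ' ((u : ℝ) : EReal) := by
  have : ∀ᶠ ℓ' : ExtCDF in 𝓝 ℓ, ∀ k ∈ Finset.range (⌊(t : ℝ) / ε⌋₊ + 1),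
      ℓ (((k - 1) * ε : ℝ) : EReal) - ε < ℓ' ((k * ε : ℝ) : EReal) :=
    (Finset.eventually_all _).2 fun k _ =>
      ℓ.eventually_gt (s := (((k - 1) * ε : ℝ) : EReal))
        (EReal.coe_lt_coe_iff.2 (by nlinarith)) (by linarith)
  filter_upwards [this] with ℓ' h u hu
  have hk : ⌊(u : ℝ) / ε⌋₊ ≤ ⌊(t : ℝ) / ε⌋₊ := Nat.floor_mono (by gcongr)
  have h1 : ⌊(u : ℝ) / ε⌋₊ * ε ≤ u := (le_div_iff₀ hε).1 (Nat.floor_le (div_nonneg u.2 hε.le))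
  have h2 : (u : ℝ) - 2 * ε ≤ (⌊(u : ℝ) / ε⌋₊ - 1) * ε := by
    have := (div_lt_iff₀ hε).1 (Nat.lt_floor_add_one ((u : ℝ) / ε))
    nlinarith
  calc ℓ (((u : ℝ) - 2 * ε : ℝ) : EReal) - ε
      ≤ ℓ (((⌊(u : ℝ) / ε⌋₊ - 1) * ε : ℝ) : EReal) - ε := by
        gcongr
        exact ℓ.mono (EReal.coe_le_coe_iff.2 h2)
    _ ≤ ℓ' ((⌊(u : ℝ) / ε⌋₊ * ε : ℝ) : EReal) := (h _ (Finset.mem_range.2 (by omega))).le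
    _ ≤ _ := ℓ'.mono (EReal.coe_le_coe_iff.2 h1)

/-- The restriction to `[0, ∞)` of a multiple of an element of `M`. -/
theorem monotone_barrier (ℓ : ExtCDF) {α : ℝ} (hα : 0 ≤ α) :
    Monotone fun s : ℝ≥0 => α * ℓ ((s : ℝ) : EReal) := fun s t hst => by
  have : ((s : ℝ) : EReal) ≤ ((t : ℝ) : EReal) := by exact_mod_cast hst
  exact mul_le_mul_of_nonneg_left (ℓ.mono this) hα

theorem rightCont_barrier (ℓ : ExtCDF) (α : ℝ) (t : ℝ≥0) :
    ContinuousWithinAt (fun s : ℝ≥0 => α * ℓ ((s : ℝ) : EReal)) (Ici t) t := by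
  refine ContinuousWithinAt.const_mul ?_ α
  refine ContinuousWithinAt.comp (g := ℓ.toFun) (f := fun s : ℝ≥0 => ((s : ℝ) : EReal))
    (ℓ.cadlag ((t : ℝ) : EReal)).1
    (continuous_coe_real_ereal.comp NNReal.continuous_coe).continuousWithinAt fun s hs => ?_
  exact EReal.coe_le_coe_iff.2 (NNReal.coe_le_coe.2 hs)

theorem isCadlag_barrier (ℓ : ExtCDF) {α : ℝ} (hα : 0 ≤ α) :
    IsCadlag fun s : ℝ≥0 => α * ℓ ((s : ℝ) : EReal) := fun t =>
  ⟨ℓ.rightCont_barrier α t, _, (ℓ.monotone_barrier hα).tendsto_nhdsLT t⟩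

end ExtCDF

/-! ### Stability of the events under perturbed barriers -/

section Semicontinuity

variable {Ω : Type*} {mΩ : MeasurableSpace Ω} {P : Measure Ω}
  {𝓕 : Filtration ℝ≥0 mΩ} {Y : ℝ≥0 → Ω → ℝ} {g : ℝ≥0 → ℝ}

/-- A path that reaches, up to time `t + ε`, the barrier raised by `K ε` and moved to the left by
`ε`, for arbitrarily small `ε`, reaches the original barrier up to time `t`. -/
theorem mem_hitSet_of_forall_nat {K : ℝ} {t : ℝ≥0} {ω : Ω} (hω : Continuous fun t => Y t ω)
    (hg : Monotone g) (hgc : ∀ t, ContinuousWithinAt g (Ici t) t) {ε : ℕ → ℝ≥0}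
    (hε : Tendsto ε atTop (𝓝 0)) (hε1 : ∀ n, ε n ≤ 1)
    (h : ∀ n, ω ∈ hitSet Y (fun u => g (u + ε n) + K * ε n) (t + ε n)) : ω ∈ hitSet Y g t := by
  choose u hut hYu using h
  obtain ⟨a, -, φ, hφ, hlim⟩ := (isCompact_Icc (a := (0 : ℝ≥0)) (b := t + 1)).tendsto_subseq
    (x := u) fun n => ⟨bot_le, (hut n).trans (add_le_add_right (hε1 n) t)⟩
  have hεφ : Tendsto (ε ∘ φ) atTop (𝓝 0) := hε.comp hφ.tendsto_atTop
  have hat : a ≤ t := by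
    simpa using le_of_tendsto_of_tendsto' hlim (tendsto_const_nhds.add hεφ) fun n => hut (φ n)
  refine ⟨a, hat, ?_⟩
  have hr : ∀ r > a, Y a ω ≤ g r := by
    intro r hr
    have h1 : ∀ᶠ n in atTop, u (φ n) + ε (φ n) < r :=
      (hlim.add hεφ).eventually (gt_mem_nhds (by simpa using hr))
    have h2 : Tendsto (fun n => Y (u (φ n)) ω) atTop (𝓝 (Y a ω)) :=
      (hω.tendsto a).comp hlim
    have h3 : Tendsto (fun n => g r + K * ε (φ n)) atTop (𝓝 (g r + K * (0 : ℝ≥0))) :=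
      tendsto_const_nhds.add (((NNReal.continuous_coe.tendsto 0).comp hεφ).const_mul K)
    have h4 := le_of_tendsto_of_tendsto h2 h3 (by
      filter_upwards [h1] with n hn
      exact (hYu (φ n)).trans (add_le_add_left (hg hn.le) _))
    simpa using h4
  refine ge_of_tendsto ((hgc a).mono Ioi_subset_Ici_self) ?_
  filter_upwards [self_mem_nhdsWithin] with r hr' using hr r hr'

/-- Continuity of the measure from above: as `ε` decreases to zero the enlarged events decrease,
almost surely into the original one. -/
theorem exists_measure_hitSet_lt [IsProbabilityMeasure P] (hYm : ∀ t, Measurable[𝓕 t] (Y t))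
    (hYc : ∀ᵐ ω ∂P, Continuous fun t => Y t ω) (hg : Monotone g)
    (hgc : ∀ t, ContinuousWithinAt g (Ici t) t) {K : ℝ} (hK : 0 ≤ K) {t : ℝ≥0} {b : ENNReal}
    (h : P (hitSet Y g t) < b) :
    ∃ ε : ℝ≥0, 0 < ε ∧ P (hitSet Y (fun u => g (u + ε) + K * ε) (t + ε)) < b := by
  set ε : ℕ → ℝ≥0 := fun n => 1 / ((n : ℝ≥0) + 1) with hεdef
  have hε0 : Tendsto ε atTop (𝓝 0) := tendsto_one_div_add_atTop_nhds_zero_nat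
  have hεanti : Antitone ε := fun m n hmn => by
    simp only [hεdef]
    gcongr
  have hε1 : ∀ n, ε n ≤ 1 := fun n => by
    simp only [hεdef]
    rw [div_le_one (by positivity)]
    simp
  set H : ℕ → Set Ω := fun n => hitSet Y (fun u => g (u + ε n) + K * ε n) (t + ε n) with hH
  have hHanti : Antitone H := fun m n hmn =>
    (hitSet_mono Y _ (add_le_add_right (hεanti hmn) t)).trans
      (hitSet_mono_barrier Y fun u _ => add_le_add (hg (add_le_add_right (hεanti hmn) u))
        (mul_le_mul_of_nonneg_left (NNReal.coe_le_coe.2 (hεanti hmn)) hK))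
  have hHm : ∀ n, NullMeasurableSet (H n) P := fun n => by
    refine nullMeasurableSet_of_eventuallyMeasurableSet
      (eventuallyMeasurableSet_hitSet hYm hYc ?_ (fun u => ?_) _)
    · exact fun u v huv => add_le_add_left (hg (add_le_add_left huv _)) _
    · refine ContinuousWithinAt.add ?_ continuousWithinAt_const
      refine ContinuousWithinAt.comp (g := g) (f := fun u => u + ε n) (hgc (u + ε n))
        (by fun_prop) fun v hv => ?_
      exact add_le_add_left (mem_Ici.1 hv) _
  have hlim := tendsto_measure_iInter_atTop hHm hHanti ⟨0, measure_ne_top _ _⟩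
  have hle : P (⋂ n, H n) ≤ P (hitSet Y g t) := by
    refine measure_mono_ae ?_
    filter_upwards [hYc] with ω hω hmem
    exact mem_hitSet_of_forall_nat hω hg hgc hε0 hε1 (mem_iInter.1 hmem)
  obtain ⟨n, hn⟩ := (hlim.eventually (gt_mem_nhds (hle.trans_lt h))).exists
  exact ⟨ε n, by positivity, hn⟩

/-- Continuity from below: a strict crossing leaves room both in time, `w < v`, and in height, so it
survives lowering and delaying the barrier slightly. -/
theorem exists_lt_measure_hitSet (ℓ : ExtCDF) {α : ℝ} (hα : 0 ≤ α) {r : ℝ≥0} {b : ENNReal}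
    (h : b < P (crossSet Y (fun s => α * ℓ ((s : ℝ) : EReal)) r)) :
    ∃ ε : ℝ, 0 < ε ∧
      b < P (hitSet Y (fun u => α * (ℓ (((u : ℝ) - 2 * ε : ℝ) : EReal) - ε)) r) := by
  set ε : ℕ → ℝ := fun n => 1 / ((n : ℝ) + 1) with hεdef
  have hε0 : Tendsto ε atTop (𝓝 0) := tendsto_one_div_add_atTop_nhds_zero_nat
  have hεanti : Antitone ε := fun m n hmn => by
    simp only [hεdef]
    gcongr
  set V : ℕ → Set Ω :=
    fun n => hitSet Y (fun u => α * (ℓ (((u : ℝ) - 2 * ε n : ℝ) : EReal) - ε n)) r with hV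
  have hVmono : Monotone V := fun m n hmn =>
    hitSet_mono_barrier Y fun u _ => mul_le_mul_of_nonneg_left
      (sub_le_sub (ℓ.mono (EReal.coe_le_coe_iff.2 (by linarith [hεanti hmn]))) (hεanti hmn)) hα
  have hsub : crossSet Y (fun s => α * ℓ ((s : ℝ) : EReal)) r ⊆ ⋃ n, V n := by
    rintro ω ⟨v, hv, w, hw, hlt⟩
    have hwv : (w : ℝ) < v := hw
    have h1 : ∀ᶠ n in atTop, ε n < ((v : ℝ) - w) / 2 :=
      hε0.eventually (gt_mem_nhds (by linarith))
    have h2 : ∀ᶠ n in atTop, α * ε n < α * ℓ ((w : ℝ) : EReal) - Y v ω :=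
      (hε0.const_mul α).eventually (gt_mem_nhds (by linarith))
    obtain ⟨n, hn1, hn2⟩ := (h1.and h2).exists
    refine mem_iUnion.2 ⟨n, v, hv, ?_⟩
    have h3 : α * ℓ ((w : ℝ) : EReal) ≤ α * ℓ (((v : ℝ) - 2 * ε n : ℝ) : EReal) :=
      mul_le_mul_of_nonneg_left (ℓ.mono (EReal.coe_le_coe_iff.2 (by linarith))) hα
    linarith
  have h' := h.trans_le (measure_mono hsub)
  rw [hVmono.measure_iUnion] at h'
  obtain ⟨n, hn⟩ := lt_iSup_iff.1 h'
  exact ⟨ε n, by positivity, hn⟩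

end Semicontinuity

/-! ### The process without losses -/

section FreeProcess

variable {Ω : Type*} {mΩ : MeasurableSpace Ω} {P : Measure Ω}
  {𝓕 : Filtration ℝ≥0 mΩ} {X0 : Ω → ℝ} {B β : ℝ≥0 → Ω → ℝ} {T : ℝ≥0} {bmax : ℝ}

/-- The process `X_{0-} + ∫₀ᵗ β_s ds + B_t` without losses. -/
noncomputable def freeProcess (X0 : Ω → ℝ) (B β : ℝ≥0 → Ω → ℝ) (t : ℝ≥0) (ω : Ω) : ℝ :=
  X0 ω + (∫ s in (0 : ℝ)..(t : ℝ), β s.toNNReal ω) + B t ω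

theorem measurable_intervalIntegral_of_progressive {m : MeasurableSpace Ω} {t : ℝ≥0}
    (hβ : StronglyMeasurable fun p : Iic t × Ω => β p.1 p.2) :
    Measurable fun ω => ∫ s in (0 : ℝ)..(t : ℝ), β s.toNNReal ω := by
  -- Capping time at `t` makes the integrand globally defined and `m`-measurable without changing it
  -- on the interval of integration.
  have h1 : StronglyMeasurable fun p : Ω × ℝ => β (min p.2.toNNReal t) p.1 :=
    hβ.comp_measurable
      (g := fun p : Ω × ℝ => ((⟨min p.2.toNNReal t, mem_Iic.2 (min_le_right _ _)⟩ : Iic t), p.1))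
      (((measurable_real_toNNReal.comp measurable_snd).min measurable_const).subtype_mk.prodMk
        measurable_fst)
  have h2 := (h1.integral_prod_right' (ν := volume.restrict (Ioc (0 : ℝ) t))).measurable
  convert h2 using 2 with ω
  rw [intervalIntegral.integral_of_le t.coe_nonneg]
  refine setIntegral_congr_fun measurableSet_Ioc fun s hs => ?_
  have : s.toNNReal ≤ t := Real.toNNReal_le_iff_le_coe.2 hs.2
  simp only [min_eq_left this]

theorem measurable_freeProcess (hB : IsBrownianWrt B 𝓕 P) (hX0 : Measurable[𝓕 0] X0)
    (hβ : IsStronglyProgressive 𝓕 β) (t : ℝ≥0) : Measurable[𝓕 t] (freeProcess X0 B β t) := by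
  have h1 : Measurable[𝓕 t] X0 := hX0.mono (𝓕.mono bot_le) le_rfl
  have h2 : Measurable[𝓕 t] fun ω => ∫ s in (0 : ℝ)..(t : ℝ), β s.toNNReal ω :=
    measurable_intervalIntegral_of_progressive (m := 𝓕 t) (hβ t)
  exact (h1.add h2).add (hB.adapted t)

/-- The extension by zero of a control to the real line. -/
theorem memLp_indicator_of_mem_controlSet {f : ℝ≥0 → ℝ} (hf : f ∈ controlSet T bmax) :
    MemLp (indicator (Ici (0 : ℝ)) fun s => f s.toNNReal) 2 volume :=
  (memLp_indicator_iff_restrict measurableSet_Ici).2 hf.1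

theorem intervalIntegrable_indicator_of_mem_controlSet {f : ℝ≥0 → ℝ}
    (hf : f ∈ controlSet T bmax) (a b : ℝ) :
    IntervalIntegrable (indicator (Ici (0 : ℝ)) fun s => f s.toNNReal) volume a b :=
  (((memLp_indicator_of_mem_controlSet hf).locallyIntegrable (by norm_num)).integrableOn_isCompact
    isCompact_uIcc).intervalIntegrable

theorem integral_indicator_eq (f : ℝ≥0 → ℝ) (t : ℝ≥0) :
    ∫ s in (0 : ℝ)..(t : ℝ), f s.toNNReal =
      ∫ s in (0 : ℝ)..(t : ℝ), indicator (Ici (0 : ℝ)) (fun s => f s.toNNReal) s := by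
  refine intervalIntegral.integral_congr fun s hs => ?_
  rw [uIcc_of_le t.coe_nonneg] at hs
  exact (indicator_of_mem (show s ∈ Ici (0 : ℝ) from hs.1)
    (fun s : ℝ => f s.toNNReal)).symm

theorem ae_continuous_freeProcess (hB : IsBrownianWrt B 𝓕 P) (hβ : IsAdmissible 𝓕 P T bmax β) :
    ∀ᵐ ω ∂P, Continuous fun t => freeProcess X0 B β t ω := by
  filter_upwards [hB.isBrownian.cont, hβ.2] with ω hBω hβω
  refine (continuous_const.add ?_).add hBω
  have h := intervalIntegral.continuous_primitive
    (intervalIntegrable_indicator_of_mem_controlSet hβω) 0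
  refine (h.comp NNReal.continuous_coe).congr fun t => ?_
  exact (integral_indicator_eq (fun t => β t ω) t).symm

/-- The positive part of `bmax` also bounds the zero extension off `[0, ∞)` and supplies the
nonnegative constant that the crossing estimate requires. -/
theorem ae_freeProcess_sub_le (hβ : IsAdmissible 𝓕 P T bmax β) :
    ∀ᵐ ω ∂P, ∀ u v : ℝ≥0, u ≤ v → freeProcess X0 B β v ω - freeProcess X0 B β u ω ≤
      max bmax 0 * (v - u) + (B v ω - B u ω) := by
  filter_upwards [hβ.2] with ω hω u v huv
  have hint := intervalIntegrable_indicator_of_mem_controlSet hω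
  have h1 := intervalIntegral.integral_interval_sub_left (hint 0 v) (hint 0 u)
  have h2 : ∀ᵐ s ∂volume, indicator (Ici (0 : ℝ)) (fun s => β s.toNNReal ω) s ≤ max bmax 0 := by
    filter_upwards [(ae_restrict_iff' measurableSet_Ici).1 hω.2.1] with s hs
    by_cases h : s ∈ Ici (0 : ℝ)
    · rw [indicator_of_mem h]
      exact (hs h).2.trans (le_max_left _ _)
    · rw [indicator_of_notMem h]
      exact le_max_right _ _
  have h3 := intervalIntegral.integral_mono_ae (μ := volume) (NNReal.coe_le_coe.2 huv) (hint u v)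
    intervalIntegrable_const h2
  rw [intervalIntegral.integral_const, smul_eq_mul] at h3
  simp only [freeProcess]
  rw [integral_indicator_eq (fun t => β t ω) u, integral_indicator_eq (fun t => β t ω) v]
  linarith

end FreeProcess

/-! ### The operator on `M` and its continuity -/

theorem EReal.neg_or_coe_or_top (t : EReal) :
    t < 0 ∨ (∃ x : ℝ≥0, t = ((x : ℝ) : EReal)) ∨ t = ⊤ := by
  induction t using EReal.rec with
  | bot => exact Or.inl (by simp)
  | top => exact Or.inr (Or.inr rfl)
  | coe x =>
    rcases lt_or_ge x 0 with h | h
    · exact Or.inl (by exact_mod_cast h)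
    · exact Or.inr (Or.inl ⟨⟨x, h⟩, rfl⟩)

section GammaOperator

variable {Ω : Type*} {mΩ : MeasurableSpace Ω} {P : Measure Ω}
  {𝓕 : Filtration ℝ≥0 mΩ} {X0 : Ω → ℝ} {B β : ℝ≥0 → Ω → ℝ} {T : ℝ≥0} {bmax α : ℝ}

theorem Gamma_of_neg (ℓ : ExtCDF) {t : EReal} (ht : t < 0) : Gamma P α X0 B β ℓ t = 0 := by
  have : {ω | defaultTime (stateProcess X0 B β fun s => α * ℓ ((s : ℝ) : EReal)) ω ≤ t} = ∅ := by
    ext ω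
    simpa using ht.trans_le (defaultTime_nonneg _ ω)
  rw [Gamma, this, measureReal_empty]

theorem Gamma_coe (hYc : ∀ᵐ ω ∂P, Continuous fun t => freeProcess X0 B β t ω) (hα : 0 ≤ α)
    (ℓ : ExtCDF) (t : ℝ≥0) : Gamma P α X0 B β ℓ ((t : ℝ) : EReal) =
      P.real (hitSet (freeProcess X0 B β) (fun s => α * ℓ ((s : ℝ) : EReal)) t) := by
  refine measureReal_congr ?_
  rw [Filter.eventuallyEq_set]
  filter_upwards [hYc] with ω hω
  exact defaultTime_le_iff hω (ℓ.monotone_barrier hα) (ℓ.rightCont_barrier α)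

/-- A fixed point of `Γ[·, β]` yields a solution. -/
theorem isSolution_of_Gamma_eq (hYc : ∀ᵐ ω ∂P, Continuous fun t => freeProcess X0 B β t ω)
    (hα : 0 ≤ α) {ℓ : ExtCDF} (h : ∀ t, Gamma P α X0 B β ℓ t = ℓ t) :
    IsSolution P α X0 B β fun t => α * ℓ ((t : ℝ) : EReal) := by
  refine ⟨ℓ.isCadlag_barrier hα, fun t => ?_⟩
  change α * ℓ ((t : ℝ) : EReal) = _
  rw [← h, Gamma_coe hYc hα]
  congr 1
  refine measureReal_congr ?_
  rw [Filter.eventuallyEq_set]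
  filter_upwards [hYc] with ω hω
  exact (iInf_le_zero_iff hω (ℓ.monotone_barrier hα) (ℓ.rightCont_barrier α)).symm

theorem IsSolution.nonneg (hα : 0 ≤ α) {Λ : ℝ≥0 → ℝ} (hΛ : IsSolution P α X0 B β Λ) (t : ℝ≥0) :
    0 ≤ Λ t := by
  rw [hΛ.2 t]
  exact mul_nonneg hα measureReal_nonneg

variable [IsProbabilityMeasure P]

theorem Gamma_mono (ℓ : ExtCDF) : Monotone (Gamma P α X0 B β ℓ) :=
  fun _ _ hst => measureReal_mono fun _ hω => le_trans hω hst

theorem Gamma_top (ℓ : ExtCDF) : Gamma P α X0 B β ℓ ⊤ = 1 := by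
  simp [Gamma]

theorem Gamma_le_Gamma (hYc : ∀ᵐ ω ∂P, Continuous fun t => freeProcess X0 B β t ω) (hα : 0 ≤ α)
    {ℓ ℓ' : ExtCDF} (h : ∀ t, ℓ t ≤ ℓ' t) (t : EReal) :
    Gamma P α X0 B β ℓ t ≤ Gamma P α X0 B β ℓ' t := by
  rcases t.neg_or_coe_or_top with ht | ⟨x, rfl⟩ | rfl
  · rw [Gamma_of_neg _ ht, Gamma_of_neg _ ht]
  · rw [Gamma_coe hYc hα, Gamma_coe hYc hα]
    exact measureReal_mono (hitSet_mono_barrier _ fun u _ => mul_le_mul_of_nonneg_left (h _) hα)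
  · rw [Gamma_top, Gamma_top]

/-- Upper semicontinuity of `Γ` jointly in the loss function and, from the right, in time. -/
theorem exists_eventually_Gamma_lt
    (hYm : ∀ t, Measurable[𝓕 t] (freeProcess X0 B β t))
    (hYc : ∀ᵐ ω ∂P, Continuous fun t => freeProcess X0 B β t ω) (hα : 0 ≤ α)
    (ℓ : ExtCDF) {t : EReal} (ht : t ≠ ⊤) {c : ℝ} (h : Gamma P α X0 B β ℓ t < c) :
    ∃ r > t, ∀ᶠ ℓ' in 𝓝 ℓ, Gamma P α X0 B β ℓ' r < c := by
  rcases t.neg_or_coe_or_top with ht' | ⟨t, rfl⟩ | rfl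
  · obtain ⟨r, htr, hr0⟩ := exists_between ht'
    rw [Gamma_of_neg _ ht'] at h
    exact ⟨r, htr, Eventually.of_forall fun ℓ' => by rwa [Gamma_of_neg _ hr0]⟩
  · rw [Gamma_coe hYc hα] at h
    have hc : 0 < c := measureReal_nonneg.trans_lt h
    obtain ⟨ε, hε, hlt⟩ := exists_measure_hitSet_lt hYm hYc (ℓ.monotone_barrier hα)
      (ℓ.rightCont_barrier α) hα
      ((ENNReal.lt_ofReal_iff_toReal_lt (measure_ne_top _ _)).2 h)
    refine ⟨((t + ε : ℝ≥0) : ℝ), ?_, ?_⟩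
    · exact EReal.coe_lt_coe_iff.2 (NNReal.coe_lt_coe.2 (lt_add_of_pos_right t hε))
    filter_upwards [ℓ.eventually_forall_lt_add (t + ε) (ε := ε) hε] with ℓ' hℓ'
    rw [Gamma_coe hYc hα]
    refine (ENNReal.lt_ofReal_iff_toReal_lt (measure_ne_top _ _)).1
      ((measure_mono (hitSet_mono_barrier _ fun u hu => ?_)).trans_lt hlt)
    rw [← mul_add, NNReal.coe_add]
    exact mul_le_mul_of_nonneg_left (hℓ' u hu) hα
  · exact absurd rfl ht

/-- The operator `Γ[·, β]` on `M`. -/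
noncomputable def gammaOperator
    (hYm : ∀ t, Measurable[𝓕 t] (freeProcess X0 B β t))
    (hYc : ∀ᵐ ω ∂P, Continuous fun t => freeProcess X0 B β t ω) (hα : 0 ≤ α)
    (ℓ : ExtCDF) : ExtCDF :=
  ExtCDF.ofMonotone (Gamma P α X0 B β ℓ) (fun _ => ⟨measureReal_nonneg, measureReal_le_one⟩)
    (Gamma_mono ℓ) (fun t => by
      rcases eq_or_ne t ⊤ with rfl | ht
      · rw [Ici_top]
        exact continuousWithinAt_singleton
      refine tendsto_order.2 ⟨fun c hc => ?_, fun c hc => ?_⟩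
      · filter_upwards [self_mem_nhdsWithin] with s hs
        exact hc.trans_le (Gamma_mono ℓ hs)
      -- Right-continuity in time is the joint semicontinuity with the loss held fixed.
      · obtain ⟨r, hr, hlt⟩ := exists_eventually_Gamma_lt hYm hYc hα ℓ ht hc
        filter_upwards [mem_nhdsWithin_of_mem_nhds (Iio_mem_nhds hr)] with s hs
        exact (Gamma_mono ℓ (mem_Iio.1 hs).le).trans_lt hlt.self_of_nhds)
    (fun _ ht => Gamma_of_neg ℓ ht) (Gamma_top ℓ)

theorem continuous_gammaOperator (hB : IsBrownianWrt B 𝓕 P)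
    (hYm : ∀ t, Measurable[𝓕 t] (freeProcess X0 B β t))
    (hYc : ∀ᵐ ω ∂P, Continuous fun t => freeProcess X0 B β t ω) (hα : 0 ≤ α) {b : ℝ} (hb : 0 ≤ b)
    (hdrift : ∀ᵐ ω ∂P, ∀ u v : ℝ≥0, u ≤ v → freeProcess X0 B β v ω - freeProcess X0 B β u ω ≤
      b * (v - u) + (B v ω - B u ω)) :
    Continuous (gammaOperator (P := P) hYm hYc hα) := by
  refine continuous_iff_continuousAt.2 fun ℓ => ExtCDF.tendsto_of_eventually
    (fun t c hc => ?_) fun s t c hst hc => ?_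
  · rcases eq_or_ne t ⊤ with rfl | ht
    · rw [ExtCDF.top_eq] at hc
      simpa only [ExtCDF.top_eq] using Eventually.of_forall fun _ => hc
    · obtain ⟨r, hr, hev⟩ := exists_eventually_Gamma_lt hYm hYc hα ℓ ht hc
      filter_upwards [hev] with ℓ' hℓ' using (Gamma_mono ℓ' hr.le).trans_lt hℓ'
  · rcases lt_or_ge c 0 with hc0 | hc0
    · exact Eventually.of_forall fun ℓ' => hc0.trans_le (ExtCDF.mem_Icc _ t).1
    rcases s.neg_or_coe_or_top with hs | ⟨s, rfl⟩ | rfl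
    · rw [ExtCDF.eq_zero_of_neg _ hs] at hc
      exact absurd hc (not_lt.2 hc0)
    · rcases t.neg_or_coe_or_top with ht | ⟨t, rfl⟩ | rfl
      · exact absurd (hst.trans ht) (not_lt.2 (by exact_mod_cast s.2))
      · have hst' : s < t := by exact_mod_cast hst
        have hc' : c < P.real (hitSet (freeProcess X0 B β)
            (fun s => α * ℓ ((s : ℝ) : EReal)) s) := by
          rw [← Gamma_coe hYc hα]
          exact hc
        have h0 := measure_hitSet_diff_crossSet hB hYm hYc hb hdrift (ℓ.monotone_barrier hα)
          (ℓ.rightCont_barrier α) hst'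
        -- A hit by time `s` is almost surely a crossing by the later time `t`, which persists for
        -- nearby losses.
        have hle := measure_mono_ae (ae_le_set.2 h0)
        obtain ⟨ε, hε, hlt⟩ := exists_lt_measure_hitSet ℓ hα
          (((ENNReal.ofReal_lt_iff_lt_toReal hc0 (measure_ne_top _ _)).2 hc').trans_le hle)
        filter_upwards [ℓ.eventually_forall_sub_lt t hε] with ℓ' hℓ'
        change c < Gamma P α X0 B β ℓ' ((t : ℝ) : EReal)
        rw [Gamma_coe hYc hα]
        refine (ENNReal.ofReal_lt_iff_lt_toReal hc0 (measure_ne_top _ _)).1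
          (hlt.trans_le (measure_mono (hitSet_mono_barrier _ fun u hu => ?_)))
        exact mul_le_mul_of_nonneg_left (hℓ' u hu) hα
      · refine Eventually.of_forall fun ℓ' => ?_
        rw [ExtCDF.top_eq]
        exact hc.trans_le (ExtCDF.mem_Icc _ _).2
    · exact absurd hst (not_lt.2 le_top)

/-- Applying `Γ[·, β]` preserves the property of lying below a given solution. -/
theorem IsSolution.mul_Gamma_le (hYc : ∀ᵐ ω ∂P, Continuous fun t => freeProcess X0 B β t ω)
    (hα : 0 ≤ α) {Λ : ℝ≥0 → ℝ} (hΛ : IsSolution P α X0 B β Λ) {ℓ : ExtCDF}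
    (h : ∀ t : ℝ≥0, α * ℓ ((t : ℝ) : EReal) ≤ Λ t) (t : ℝ≥0) :
    α * Gamma P α X0 B β ℓ ((t : ℝ) : EReal) ≤ Λ t := by
  rw [Gamma_coe hYc hα, hΛ.2 t]
  refine mul_le_mul_of_nonneg_left (measureReal_mono ?_) hα
  -- Only the trivial implication from a hit to a nonpositive infimum is used, so no monotonicity of
  -- `Λ` is needed.
  exact fun ω hω => iInf_le_zero_of_mem_hitSet (hitSet_mono_barrier _ (fun u _ => h u) hω)

end GammaOperator

/-! ### Iteration from zero and the minimal solution -/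

theorem ExtCDF.zero_coe (t : ℝ≥0) : zero ((t : ℝ) : EReal) = 0 := by
  change indicator {⊤} (fun _ => (1 : ℝ)) ((t : ℝ) : EReal) = 0
  simp

theorem ExtCDF.monotone_iterate_zero {G : ExtCDF → ExtCDF}
    (hG : ∀ ℓ ℓ' : ExtCDF, (∀ t, ℓ t ≤ ℓ' t) → ∀ t, G ℓ t ≤ G ℓ' t) (t : EReal) :
    Monotone fun k : ℕ => G^[k] zero t := by
  refine monotone_nat_of_le_succ fun k => ?_
  induction k generalizing t with
  | zero => exact zero_le _ t
  | succ k ih =>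
    rw [Function.iterate_succ_apply', Function.iterate_succ_apply']
    exact hG _ _ ih t

theorem mainTheorem6 {Ω : Type*} {mΩ : MeasurableSpace Ω} (P : Measure Ω) [IsProbabilityMeasure P]
    (𝓕 : Filtration ℝ≥0 mΩ) (B : ℝ≥0 → Ω → ℝ) (hB : IsBrownianWrt B 𝓕 P)
    (X0 : Ω → ℝ) (hX0 : Measurable[𝓕 0] X0)
    (α : ℝ) (hα : 0 ≤ α) (T : ℝ≥0) (bmax : ℝ)
    (β : ℝ≥0 → Ω → ℝ) (hβ : IsAdmissible 𝓕 P T bmax β) :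
    ∃ G : ExtCDF → ExtCDF,
      (∀ (ℓ : ExtCDF) (t : EReal), G ℓ t = Gamma P α X0 B β ℓ t) ∧
      Continuous G ∧
      (∃! Λ : ℝ≥0 → ℝ, IsMinimalSolution P α X0 B β Λ) ∧
      ∃ ℓ : ExtCDF, Tendsto (fun k : ℕ => G^[k] ExtCDF.zero) atTop (𝓝 ℓ) ∧
        IsMinimalSolution P α X0 B β (fun t => α * ℓ ((t : ℝ) : EReal)) := by
  have hYm := measurable_freeProcess hB hX0 hβ.1
  have hYc := ae_continuous_freeProcess (X0 := X0) hB hβ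
  set G := gammaOperator (P := P) hYm hYc hα with hGdef
  have hG : Continuous G := continuous_gammaOperator hB hYm hYc hα (le_max_right bmax 0)
    (ae_freeProcess_sub_le hβ)
  obtain ⟨ℓ, hℓ⟩ := ExtCDF.exists_tendsto_of_monotone
    (ExtCDF.monotone_iterate_zero (G := G) fun _ _ h => Gamma_le_Gamma hYc hα h)
  have hfix : G ℓ = ℓ := by
    refine ExtCDF.tendsto_unique ((hG.tendsto ℓ).comp hℓ) ?_
    refine (hℓ.comp (tendsto_add_atTop_nat 1)).congr fun k => ?_
    exact Function.iterate_succ_apply' G k _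
  have hmin : IsMinimalSolution P α X0 B β fun t => α * ℓ ((t : ℝ) : EReal) := by
    refine ⟨isSolution_of_Gamma_eq hYc hα fun t => congrArg (fun a : ExtCDF => a t) hfix,
      fun Λ hΛ => ?_⟩
    have hk : ∀ (k : ℕ) (t : ℝ≥0), α * G^[k] ExtCDF.zero ((t : ℝ) : EReal) ≤ Λ t := by
      intro k
      induction k with
      | zero =>
        intro t
        rw [Function.iterate_zero_apply, ExtCDF.zero_coe, mul_zero]
        exact hΛ.nonneg hα t
      | succ k ih =>
        intro t
        rw [Function.iterate_succ_apply']
        exact hΛ.mul_Gamma_le hYc hα ih t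
    intro t
    -- A weak limit inherits the bound at `s` only at times before `s`, so let `s` decrease to `t`.
    refine ge_of_tendsto ((hΛ.1 t).1.mono Ioi_subset_Ici_self) ?_
    filter_upwards [self_mem_nhdsWithin] with s hs
    have hts : ((t : ℝ) : EReal) < ((s : ℝ) : EReal) :=
      EReal.coe_lt_coe_iff.2 (NNReal.coe_lt_coe.2 hs)
    rcases hα.eq_or_lt with rfl | hα0
    · rw [zero_mul]
      exact hΛ.nonneg le_rfl s
    · rw [← le_div_iff₀' hα0]
      exact ExtCDF.le_of_tendsto_of_lt hℓ hts fun k => (le_div_iff₀' hα0).2 (hk k s)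
  refine ⟨G, fun _ _ => rfl, hG, ⟨_, hmin, fun Λ hΛ => ?_⟩, ℓ, hℓ, hmin⟩
  exact funext fun t => le_antisymm (hΛ.2 _ hmin.1 t) (hmin.2 _ hΛ.1 t)
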